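/- Let $n\ge 2$ and let $\Omega\subset\mathbb{R}^n$ be a bounded domain (a nonempty, bounded, open, connected set). Write $|A|$ for the Lebesgue measure of $A$, let "measurable" mean Lebesgue measurable, and write $A\Subset\Omega$ if $\overline A$ is compact and contained in $\Omega$. *Definitions.* A map $h:\Omega\to\mathbb{R}^n$ satisfies the Lusin condition (N) if $|h(Z)|=0$ for every $Z\subset\Omega$ with $|Z|=0$. A measurable map $h:\Omega\to\mathbb{R}^n$ is approximately differentiable at $x\in\Omega$ if there are a measurable set $E_x$ of Lebesgue density $1$ at $x$ and a linear map $L:\mathbb{R}^n\to\mathbb{R}^n$ such that $$\lim_{y\to x,\ y\in E_x}\frac{|h(y)-h(x)-L(y-x)|}{|y-x|}=0 ;$$ then $L$ is unique, and $J_{\rm a}h(x):=\det L$ is the approximate Jacobian of $h$ at $x$. For a bounded open set $U$, a continuous map $h:\overline U\to\mathbb{R}^n$ and $y\notin h(\partial U)$, $\deg(h,U,y)\in\mathbb{Z}$ denotes the topological (Brouwer) degree: it is the common value of $$\sum_{x\in U,\ g(x)=y}\operatorname{sgn}\det Dg(x)$$ over all maps $g$ of class $C^1$ on an open set containing $\overline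 U$ such that $|g-h|<\operatorname{dist}(y,h(\partial U))$ on $\overline U$ and $\det Dg(x)\neq0$ for all $x\in\overline U$ with $g(x)=y$. **Theorem.** Let $f_k:\Omega\to\mathbb{R}^n$ ($k\in\mathbb{N}$) be continuous maps converging locally uniformly in $\Omega$ to a map $f:\Omega\to\mathbb{R}^n$. Assume that all $f_k$ and $f$ satisfy the Lusin condition (N) and are approximately differentiable almost everywhere in $\Omega$, and that the family $\{J_{\rm a}f_k\}_k$ is uniformly integrable on every compact subset of $\Omega$. Suppose that for every domain $U\Subset\Omega$ with $|\partial U|=0$, $$\deg(f,U,y)\neq 0\quad\text{for a.e. } y\in f(U).$$ (Since $f$ satisfies (N), $|f(\partial U)|=0$, so the degree is defined for a.e. $y$.) Then $$\lim_{k\to\infty}|f_k(E)|=|f(E)|\qquad\text{for every measurable set } E\Subset\Omega .$$ -/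

import Mathlib

open MeasureTheory Filter Topology

/-- The set `E` is Lebesgue measurable and has Lebesgue density `1` at the point `x`. -/
def HasDensityOneAt {n : ℕ} (E : Set (EuclideanSpace ℝ (Fin n)))
    (x : EuclideanSpace ℝ (Fin n)) : Prop :=
  NullMeasurableSet E volume ∧
    Tendsto (fun r : ℝ => volume (E ∩ Metric.closedBall x r) / volume (Metric.closedBall x r))
      (𝓝[>] 0) (𝓝 1)

/-- `f` is approximately differentiable at `x` with approximate derivative `L`: there is a
measurable set `E` of density `1` at `x` such that
`|f y - f x - L (y - x)| / |y - x| → 0` as `y → x` within `E`.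
(This is local: only the values of `f` near `x` matter.) -/
def HasApproxFDerivAt {n : ℕ} (f : EuclideanSpace ℝ (Fin n) → EuclideanSpace ℝ (Fin n))
    (L : EuclideanSpace ℝ (Fin n) →L[ℝ] EuclideanSpace ℝ (Fin n))
    (x : EuclideanSpace ℝ (Fin n)) : Prop :=
  ∃ E : Set (EuclideanSpace ℝ (Fin n)), HasDensityOneAt E x ∧ HasFDerivWithinAt f L E x

/-- `f` is approximately differentiable at `x`. -/
def ApproxDifferentiableAt {n : ℕ}
    (f : EuclideanSpace ℝ (Fin n) → EuclideanSpace ℝ (Fin n))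
    (x : EuclideanSpace ℝ (Fin n)) : Prop :=
  ∃ L, HasApproxFDerivAt f L x

open Classical in
/-- The approximate derivative of `f` at `x` (unique where it exists; `0` where `f` is not
approximately differentiable). -/
noncomputable def approxFDeriv {n : ℕ}
    (f : EuclideanSpace ℝ (Fin n) → EuclideanSpace ℝ (Fin n))
    (x : EuclideanSpace ℝ (Fin n)) :
    EuclideanSpace ℝ (Fin n) →L[ℝ] EuclideanSpace ℝ (Fin n) :=
  if h : ApproxDifferentiableAt f x then Classical.choose h else 0

/-- The approximate Jacobian: the determinant of the approximate derivative. -/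
noncomputable def approxJacobian {n : ℕ}
    (f : EuclideanSpace ℝ (Fin n) → EuclideanSpace ℝ (Fin n))
    (x : EuclideanSpace ℝ (Fin n)) : ℝ :=
  (approxFDeriv f x).det

/-- The Lusin condition (N) on `Ω`: Lebesgue null subsets of `Ω` have null images. -/
def LusinN {n : ℕ} (f : EuclideanSpace ℝ (Fin n) → EuclideanSpace ℝ (Fin n))
    (Ω : Set (EuclideanSpace ℝ (Fin n))) : Prop :=
  ∀ Z ⊆ Ω, volume Z = 0 → volume (f '' Z) = 0

/-- `A` is compactly contained in `Ω`. -/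
def CompactlyContained {n : ℕ} (A Ω : Set (EuclideanSpace ℝ (Fin n))) : Prop :=
  IsCompact (closure A) ∧ closure A ⊆ Ω

/-- `g` is of class `C¹` on the closure of `U`, that is, on an open set containing it. -/
def IsC1OnClosure {n : ℕ} (g : EuclideanSpace ℝ (Fin n) → EuclideanSpace ℝ (Fin n))
    (U : Set (EuclideanSpace ℝ (Fin n))) : Prop :=
  ∃ V, IsOpen V ∧ closure U ⊆ V ∧ ContDiffOn ℝ 1 g V

/-- The point `p` does not lie in `g(Z_g) ∪ g(∂U)`, where `Z_g` is the set of points of the closure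
of `U` at which the Jacobian of `g` vanishes. -/
def IsRegularValueFor {n : ℕ} (g : EuclideanSpace ℝ (Fin n) → EuclideanSpace ℝ (Fin n))
    (U : Set (EuclideanSpace ℝ (Fin n))) (p : EuclideanSpace ℝ (Fin n)) : Prop :=
  p ∉ g '' {x ∈ closure U | (fderiv ℝ g x).det = 0} ∪ g '' frontier U

/-- The degree of a `C¹` map at a regular value: the sum of the signs of the Jacobian over the
preimages of `p` in `U` (a finite set when `U` is bounded). -/
noncomputable def regularDegree {n : ℕ}
    (g : EuclideanSpace ℝ (Fin n) → EuclideanSpace ℝ (Fin n))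
    (U : Set (EuclideanSpace ℝ (Fin n))) (p : EuclideanSpace ℝ (Fin n)) : ℤ :=
  ∑ᶠ x ∈ U ∩ g ⁻¹' {p}, (SignType.sign (fderiv ℝ g x).det : ℤ)

/-- The integer `d` is the Brouwer degree of `f` on `U` at `p ∉ f(∂U)`: it is the degree at `p`
of every `C¹` map `g` which has `p` as a regular value and satisfies
`|g - f| < dist(p, f(∂U))` on the closure of `U`.
(For `U` bounded and open, `f` continuous on the closure of `U` and `p ∉ f(∂U)`, such maps `g`
exist and they all have the same degree at `p`, so there is exactly one such `d`.) -/
def IsBrouwerDegree {n : ℕ} (f : EuclideanSpace ℝ (Fin n) → EuclideanSpace ℝ (Fin n))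
    (U : Set (EuclideanSpace ℝ (Fin n))) (p : EuclideanSpace ℝ (Fin n)) (d : ℤ) : Prop :=
  p ∉ f '' frontier U ∧
    ∀ g : EuclideanSpace ℝ (Fin n) → EuclideanSpace ℝ (Fin n),
      IsC1OnClosure g U →
      (∀ x ∈ closure U, dist (g x) (f x) < Metric.infDist p (f '' frontier U)) →
      IsRegularValueFor g U p → regularDegree g U p = d

open Classical in
/-- The Brouwer degree `deg(f, U, p)`, with value `0` where it is not defined
(in particular for `p ∈ f(∂U)`). -/
noncomputable def brouwerDegree {n : ℕ}
    (f : EuclideanSpace ℝ (Fin n) → EuclideanSpace ℝ (Fin n))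
    (U : Set (EuclideanSpace ℝ (Fin n))) (p : EuclideanSpace ℝ (Fin n)) : ℤ :=
  if h : ∃ d, IsBrouwerDegree f U p d then Classical.choose h else 0

/-! ### Approximate derivatives and the area inequality -/

section ApproximateDifferentiability

open Set Metric

variable {n : ℕ} {h : EuclideanSpace ℝ (Fin n) → EuclideanSpace ℝ (Fin n)}
  {x : EuclideanSpace ℝ (Fin n)} {s t Ω : Set (EuclideanSpace ℝ (Fin n))}

/-! Image volume is lower semicontinuous on open sets and upper semicontinuous on compact sets, and
uniform integrability closes the gap for measurable sets.

Open `V`: nonzero degree survives small uniform perturbations, so almost every `y ∈ f '' V` is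
eventually in `fk k '' V`. A Fatou argument gives `volume (f '' V) ≤ liminf`
(`ae_eventually_mem_image`, `measure_le_liminf_of_ae_eventually_mem`). Compact `C`: `fk k '' C`
eventually lies in any thickening of `f '' C` (`limsup_volume_image_le_of_isCompact`).

A measurable `E` is squeezed between such sets up to small measure. The error is uniform in `k` by
the area inequality `volume_image_le_lintegral_approxJacobian`. That inequality is proved by
splitting the domain into countably many Lipschitz pieces and a null set, which condition (N) makes
harmless. -/

theorem ApproxDifferentiableAt.hasApproxFDerivAt (hh : ApproxDifferentiableAt h x) :
    HasApproxFDerivAt h (approxFDeriv h x) x := by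
  have : approxFDeriv h x = Classical.choose hh := dif_pos hh
  rw [this]
  exact Classical.choose_spec hh

/-- The complement of a set of density one has density zero. -/
theorem HasDensityOneAt.tendsto_diff (hs : HasDensityOneAt s x) :
    Tendsto (fun r : ℝ => volume (closedBall x r \ s) / volume (closedBall x r))
      (𝓝[>] 0) (𝓝 0) := by
  have h1 : Tendsto (fun r : ℝ =>
      1 - volume (s ∩ closedBall x r) / volume (closedBall x r)) (𝓝[>] 0) (𝓝 (1 - 1)) :=
    ENNReal.Tendsto.sub tendsto_const_nhds hs.2 (Or.inl ENNReal.one_ne_top)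
  rw [tsub_self] at h1
  refine h1.congr' ?_
  filter_upwards [self_mem_nhdsWithin] with r hr
  have hr : 0 < r := hr
  have hpos : volume (closedBall x r) ≠ 0 := (measure_closedBall_pos volume x hr).ne'
  have htop : volume (closedBall x r) ≠ ⊤ := measure_closedBall_lt_top.ne
  have hfin : volume (s ∩ closedBall x r) / volume (closedBall x r) ≠ ⊤ :=
    ENNReal.div_ne_top (measure_ne_top_of_subset inter_subset_right htop) hpos
  refine (ENNReal.eq_sub_of_add_eq hfin ?_).symm
  rw [← ENNReal.add_div, inter_comm, add_comm, measure_inter_add_sdiff₀ _ hs.1,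
    ENNReal.div_self hpos htop]

theorem HasDensityOneAt.inter (hs : HasDensityOneAt s x) (ht : HasDensityOneAt t x) :
    HasDensityOneAt (s ∩ t) x := by
  refine ⟨hs.1.inter ht.1, ?_⟩
  have h1 : Tendsto (fun r : ℝ =>
      1 - (volume (closedBall x r \ s) / volume (closedBall x r) +
        volume (closedBall x r \ t) / volume (closedBall x r))) (𝓝[>] 0) (𝓝 (1 - (0 + 0))) :=
    ENNReal.Tendsto.sub tendsto_const_nhds (hs.tendsto_diff.add ht.tendsto_diff)
      (Or.inl ENNReal.one_ne_top)
  rw [add_zero, tsub_zero] at h1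
  refine tendsto_of_tendsto_of_tendsto_of_le_of_le' h1 tendsto_const_nhds ?_ ?_
  · filter_upwards [self_mem_nhdsWithin] with r hr
    have hr : 0 < r := hr
    have hpos : volume (closedBall x r) ≠ 0 := (measure_closedBall_pos volume x hr).ne'
    have htop : volume (closedBall x r) ≠ ⊤ := measure_closedBall_lt_top.ne
    rw [tsub_le_iff_right, ← ENNReal.add_div, ← ENNReal.add_div]
    nth_rewrite 1 [← ENNReal.div_self hpos htop]
    gcongr
    calc volume (closedBall x r)
        ≤ volume (s ∩ t ∩ closedBall x r ∪ (closedBall x r \ s ∪ closedBall x r \ t)) := by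
          refine measure_mono fun y hy => ?_
          by_cases hys : y ∈ s <;> by_cases hyt : y ∈ t <;> simp_all
      _ ≤ _ := (measure_union_le _ _).trans (by gcongr; exact measure_union_le _ _)
  · refine Eventually.of_forall fun r => ENNReal.div_le_of_le_mul ?_
    rw [one_mul]
    exact measure_mono inter_subset_right

/-- A set of density one meets every small rescaled ball `x + r • ball v ε`. Hence the difference
`D` of the derivatives satisfies `‖D w‖ ≤ ε * ‖w‖` at some `w` within `ε` of `v`; now let `ε → 0`.
-/
theorem HasDensityOneAt.eq_of_hasFDerivWithinAt
    {L₁ L₂ : EuclideanSpace ℝ (Fin n) →L[ℝ] EuclideanSpace ℝ (Fin n)}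
    (hs : HasDensityOneAt s x) (h₁ : HasFDerivWithinAt h L₁ s x)
    (h₂ : HasFDerivWithinAt h L₂ s x) : L₁ = L₂ := by
  have hD : HasFDerivWithinAt (fun y => h y - h y) (L₁ - L₂) s x := h₁.sub h₂
  set D := L₁ - L₂
  suffices ∀ v, D v = 0 from sub_eq_zero.1 (ContinuousLinearMap.ext this)
  intro v
  have key : ∀ ε : ℝ, 0 < ε → ‖D v‖ ≤ ε * (‖v‖ + ε) + ‖D‖ * ε := by
    intro ε hε
    have hb := hD.isLittleO.def hε
    rw [eventually_nhdsWithin_iff, Metric.eventually_nhds_iff] at hb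
    obtain ⟨δ, hδ, hb⟩ := hb
    have hne := Measure.eventually_nonempty_inter_smul_of_density_one volume s x hs.2
      (ball v ε) measurableSet_ball (measure_ball_pos volume v hε).ne'
    have hsm : ∀ᶠ r in 𝓝[>] (0 : ℝ), r * (‖v‖ + ε) < δ := by
      have : Tendsto (fun r : ℝ => r * (‖v‖ + ε)) (𝓝[>] 0) (𝓝 (0 * (‖v‖ + ε))) :=
        ((continuous_id.mul continuous_const).tendsto 0).mono_left nhdsWithin_le_nhds
      rw [zero_mul] at this
      exact this.eventually_lt_const hδ
    obtain ⟨r, ⟨y, hys, hy⟩, hrδ, hr⟩ :=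
      (hne.and (hsm.and self_mem_nhdsWithin)).exists
    have hr : 0 < r := hr
    obtain ⟨x', hx', _, ⟨w, hw, rfl⟩, hy⟩ := hy
    obtain rfl : x + r • w = y := by rw [← hy, mem_singleton_iff.1 hx']
    have hwv : ‖w - v‖ < ε := by rwa [← dist_eq_norm]
    have hwn : ‖w‖ ≤ ‖v‖ + ε := by
      calc ‖w‖ = ‖v + (w - v)‖ := by congr 1; abel
        _ ≤ _ := (norm_add_le _ _).trans (by gcongr)
    have hyd : dist (x + r • w) x < δ := by
      rw [dist_eq_norm, add_sub_cancel_left, norm_smul, Real.norm_of_nonneg hr.le]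
      exact (by gcongr : r * ‖w‖ ≤ r * (‖v‖ + ε)).trans_lt hrδ
    have := hb (y := x + r • w) hyd hys
    simp only [sub_self, add_sub_cancel_left, zero_sub, norm_neg, map_smul, norm_smul,
      Real.norm_of_nonneg hr.le] at this
    have hDw : ‖D w‖ ≤ ε * ‖w‖ := by
      refine le_of_mul_le_mul_left ?_ hr
      linarith
    calc ‖D v‖ = ‖D w - D (w - v)‖ := by rw [map_sub, sub_sub_cancel]
      _ ≤ ‖D w‖ + ‖D (w - v)‖ := norm_sub_le _ _
      _ ≤ ε * (‖v‖ + ε) + ‖D‖ * ε := by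
          gcongr
          · exact hDw.trans (by gcongr)
          · exact (D.le_opNorm _).trans (by gcongr)
  have hlim : Tendsto (fun ε : ℝ => ε * (‖v‖ + ε) + ‖D‖ * ε) (𝓝[>] 0) (𝓝 0) := by
    have : Continuous (fun ε : ℝ => ε * (‖v‖ + ε) + ‖D‖ * ε) := by fun_prop
    simpa using (this.tendsto 0).mono_left nhdsWithin_le_nhds
  have : ‖D v‖ ≤ 0 := ge_of_tendsto hlim (by
    filter_upwards [self_mem_nhdsWithin] with ε hε using key ε hε)
  simpa using this

/-- The area inequality on a set on which the map is Lipschitz. -/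
theorem LipschitzOnWith.volume_image_le_lintegral_approxJacobian {K : NNReal}
    (hh : LipschitzOnWith K h s) (hs : MeasurableSet s) (hN : LusinN h s)
    (hd : ∀ᵐ x ∂volume.restrict s, ApproxDifferentiableAt h x) :
    volume (h '' s) ≤ ∫⁻ x in s, ‖approxJacobian h x‖ₑ := by
  -- Rademacher gives a derivative within `s`. At density points of `s` it agrees with the
  -- approximate one, by uniqueness on `s ∩ E`.
  have hae : ∀ᵐ x ∂volume.restrict s, HasFDerivWithinAt h (approxFDeriv h x) s x := by
    filter_upwards [hd, hh.ae_differentiableWithinAt (μ := volume) hs,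
      Besicovitch.ae_tendsto_measure_inter_div volume s] with x hx hxs hxd
    obtain ⟨E, hE, hE'⟩ := hx.hasApproxFDerivAt
    have hds : HasDensityOneAt s x := ⟨hs.nullMeasurableSet, hxd⟩
    rw [(hds.inter hE).eq_of_hasFDerivWithinAt (hE'.mono inter_subset_right)
      (hxs.hasFDerivWithinAt.mono inter_subset_left)]
    exact hxs.hasFDerivWithinAt
  rw [ae_restrict_iff' hs] at hae
  obtain ⟨Z, hZ, hZm, hZ0⟩ := exists_measurable_superset_of_null (ae_iff.1 hae)
  have hder : ∀ x ∈ s \ Z, HasFDerivWithinAt h (approxFDeriv h x) (s \ Z) x := by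
    intro x hx
    have : x ∉ {a | ¬(a ∈ s → HasFDerivWithinAt h (approxFDeriv h a) s a)} :=
      fun hx' => hx.2 (hZ hx')
    simp only [mem_ofPred_eq, not_not] at this
    exact (this hx.1).mono sdiff_subset
  calc volume (h '' s) ≤ volume (h '' (s ∩ Z)) + volume (h '' (s \ Z)) := by
        conv_lhs => rw [← inter_union_sdiff s Z, image_union]
        exact measure_union_le _ _
    _ = volume (h '' (s \ Z)) := by
        rw [hN _ inter_subset_left (measure_mono_null inter_subset_right hZ0), zero_add]
    _ ≤ ∫⁻ x in s \ Z, ENNReal.ofReal |(approxFDeriv h x).det| :=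
        addHaar_image_le_lintegral_abs_det_fderiv volume (hs.diff hZm) hder
    _ = ∫⁻ x in s \ Z, ‖approxJacobian h x‖ₑ := by
        simp only [approxJacobian, Real.enorm_eq_ofReal_abs]
    _ ≤ _ := lintegral_mono_set sdiff_subset

/-- The points `x` near which, on all balls of radius at most `1 / (j + 1)` around `x`, the
difference quotients of `h` at `x` are bounded by `j` up to a small proportion of the ball. -/
def approxLipschitzSet (h : EuclideanSpace ℝ (Fin n) → EuclideanSpace ℝ (Fin n)) (j : ℕ) :
    Set (EuclideanSpace ℝ (Fin n)) :=
  {x | ∀ r : ℝ, 0 < r → r ≤ 1 / (j + 1) →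
    volume {y ∈ closedBall x r | j * dist y x < dist (h y) (h x)} ≤
      ENNReal.ofReal ((1 / 2) ^ (n + 2)) * volume (closedBall x r)}

/-- Difference quotients are bounded on the density-one set near `x`, and its complement fills a
vanishing proportion of small balls. -/
theorem ApproxDifferentiableAt.exists_mem_approxLipschitzSet (hh : ApproxDifferentiableAt h x) :
    ∃ j, x ∈ approxLipschitzSet h j := by
  obtain ⟨L, E, hE, hL⟩ := hh
  obtain ⟨C, hC⟩ := hL.isBigO_sub.bound
  rw [eventually_nhdsWithin_iff, Metric.eventually_nhds_iff] at hC
  obtain ⟨δ, hδ, hC⟩ := hC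
  have hc : (0 : ENNReal) < ENNReal.ofReal ((1 / 2) ^ (n + 2)) := by
    rw [ENNReal.ofReal_pos]; positivity
  have hev := hE.tendsto_diff.eventually_lt_const hc
  rw [eventually_nhdsWithin_iff, Metric.eventually_nhds_iff] at hev
  obtain ⟨η, hη, hev⟩ := hev
  obtain ⟨j₁, hj₁⟩ := exists_nat_ge C
  obtain ⟨j₂, hj₂⟩ := exists_nat_one_div_lt (lt_min hδ hη)
  refine ⟨max j₁ j₂, fun r hr hrj => ?_⟩
  have hrmin : r < min δ η := by
    refine (hrj.trans ?_).trans_lt hj₂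
    gcongr
    exact le_max_right _ _
  have h1 := hev (y := r) (by
    rw [Real.dist_eq, sub_zero, abs_of_pos hr]; exact hrmin.trans_le (min_le_right _ _)) hr
  have hpos : volume (closedBall x r) ≠ 0 := (measure_closedBall_pos volume x hr).ne'
  have htop : volume (closedBall x r) ≠ ⊤ := measure_closedBall_lt_top.ne
  rw [ENNReal.div_lt_iff (Or.inl hpos) (Or.inl htop)] at h1
  refine (measure_mono ?_).trans h1.le
  rintro y ⟨hy, hlt⟩
  refine ⟨hy, fun hyE => hlt.not_ge ?_⟩
  have := hC (lt_of_le_of_lt (mem_closedBall.1 hy) (hrmin.trans_le (min_le_left _ _))) hyE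
  rw [← dist_eq_norm, ← dist_eq_norm] at this
  refine this.trans ?_
  gcongr
  exact hj₁.trans (by exact_mod_cast le_max_left _ _)

/-- With `d = dist x x'`, the ball of radius `d / 2` at the midpoint lies in both `d`-balls and has
`2⁻ⁿ` of their volume. The two bad sets total at most `2 · 2⁻⁽ⁿ⁺²⁾` of it, so some `y` is good for
both points. -/
theorem dist_le_of_mem_approxLipschitzSet {j : ℕ} {x' : EuclideanSpace ℝ (Fin n)}
    (hx : x ∈ approxLipschitzSet h j) (hx' : x' ∈ approxLipschitzSet h j)
    (hxx' : dist x x' ≤ 1 / (j + 1)) : dist (h x) (h x') ≤ 2 * j * dist x x' := by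
  rcases eq_or_ne x x' with rfl | hne
  · simp
  set d := dist x x' with hd
  have hd0 : 0 < d := dist_pos.2 hne
  have hsub₁ : closedBall (midpoint ℝ x x') (1 / 2 * d) ⊆ closedBall x d := by
    refine closedBall_subset_closedBall' ?_
    rw [dist_midpoint_left, Real.norm_ofNat]
    linarith
  have hsub₂ : closedBall (midpoint ℝ x x') (1 / 2 * d) ⊆ closedBall x' d := by
    refine closedBall_subset_closedBall' ?_
    rw [dist_midpoint_right, Real.norm_ofNat]
    linarith
  have hvol : ∀ z : EuclideanSpace ℝ (Fin n),
      volume (closedBall z d) = volume (closedBall (0 : EuclideanSpace ℝ (Fin n)) d) := fun z =>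
    Measure.addHaar_closedBall_center volume z d
  have hmid : volume (closedBall (midpoint ℝ x x') (1 / 2 * d)) =
      ENNReal.ofReal ((1 / 2) ^ n) * volume (closedBall (0 : EuclideanSpace ℝ (Fin n)) d) := by
    rw [Measure.addHaar_closedBall_mul volume _ (by norm_num) hd0.le, finrank_euclideanSpace_fin]
  obtain ⟨y, hy, hyx, hyx'⟩ : ∃ y ∈ closedBall (midpoint ℝ x x') (1 / 2 * d),
      dist (h y) (h x) ≤ j * dist y x ∧ dist (h y) (h x') ≤ j * dist y x' := by
    by_contra! hcon
    have hle : volume (closedBall (midpoint ℝ x x') (1 / 2 * d)) ≤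
        ENNReal.ofReal ((1 / 2) ^ (n + 1)) *
          volume (closedBall (0 : EuclideanSpace ℝ (Fin n)) d) := by
      calc _ ≤ volume ({y ∈ closedBall x d | j * dist y x < dist (h y) (h x)} ∪
            {y ∈ closedBall x' d | j * dist y x' < dist (h y) (h x')}) := by
            refine measure_mono fun y hy => ?_
            by_cases hyx : dist (h y) (h x) ≤ j * dist y x
            · exact Or.inr ⟨hsub₂ hy, hcon y hy hyx⟩
            · exact Or.inl ⟨hsub₁ hy, not_le.1 hyx⟩
        _ ≤ _ := (measure_union_le _ _).trans (add_le_add (hx d hd0 hxx') (hx' d hd0 hxx'))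
        _ = _ := by
            rw [hvol x, hvol x', ← add_mul, ← ENNReal.ofReal_add (by positivity) (by positivity)]
            congr 2
            ring
    rw [hmid] at hle
    have hpos : volume (closedBall (0 : EuclideanSpace ℝ (Fin n)) d) ≠ 0 :=
      (measure_closedBall_pos volume _ hd0).ne'
    have htop : volume (closedBall (0 : EuclideanSpace ℝ (Fin n)) d) ≠ ⊤ :=
      measure_closedBall_lt_top.ne
    rw [ENNReal.mul_le_mul_iff_left hpos htop, ENNReal.ofReal_le_ofReal_iff (by positivity),
      pow_succ] at hle
    have : (0 : ℝ) < (1 / 2) ^ n := by positivity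
    linarith
  have h1 : dist y x ≤ d := hsub₁ hy
  have h2 : dist y x' ≤ d := hsub₂ hy
  calc dist (h x) (h x') ≤ dist (h y) (h x) + dist (h y) (h x') := dist_triangle_left _ _ _
    _ ≤ j * d + j * d := add_le_add (hyx.trans (by gcongr)) (hyx'.trans (by gcongr))
    _ = 2 * j * d := by ring

/-- Up to points where `h` is not approximately differentiable, an open set is a countable union
of relatively closed pieces on which the continuous map `h` is Lipschitz. -/
theorem exists_measurableSet_lipschitzOnWith_cover (hΩ : IsOpen Ω) (hh : ContinuousOn h Ω) :
    ∃ P : ℕ → Set (EuclideanSpace ℝ (Fin n)), (∀ i, MeasurableSet (P i)) ∧ (∀ i, P i ⊆ Ω) ∧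
      (∀ i, ∃ K, LipschitzOnWith K h (P i)) ∧
      ∀ x ∈ Ω, ApproxDifferentiableAt h x → x ∈ ⋃ i, P i := by
  let z := TopologicalSpace.denseSeq (EuclideanSpace ℝ (Fin n))
  let Q : ℕ → ℕ → Set (EuclideanSpace ℝ (Fin n)) := fun j i =>
    Ω ∩ approxLipschitzSet h j ∩ closedBall (z i) (1 / (2 * (j + 1)))
  have hQ : ∀ j i, LipschitzOnWith ((2 * j : ℕ) : NNReal) h (Q j i) := by
    intro j i
    refine LipschitzOnWith.of_dist_le_mul fun x hx x' hx' => ?_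
    have := dist_le_of_mem_approxLipschitzSet hx.1.2 hx'.1.2 (by
      calc dist x x' ≤ dist x (z i) + dist x' (z i) := dist_triangle_right _ _ _
        _ ≤ 1 / (2 * (j + 1)) + 1 / (2 * (j + 1)) := add_le_add hx.2 hx'.2
        _ = 1 / (j + 1) := by field_simp; norm_num)
    simpa using this
  -- Relative closures make the pieces measurable. A Lipschitz extension of `h` from `Q` agrees with
  -- `h` on them by continuity.
  refine ⟨fun m => Ω ∩ closure (Q m.unpair.1 m.unpair.2),
    fun m => hΩ.measurableSet.inter isClosed_closure.measurableSet, fun m => inter_subset_left,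
    fun m => ?_, fun x hx hd => ?_⟩
  · obtain ⟨g, hg, hgh⟩ := (hQ m.unpair.1 m.unpair.2).extend_finite_dimension
    have heq : EqOn h g (Ω ∩ closure (Q m.unpair.1 m.unpair.2)) :=
      hgh.of_subset_closure (hh.mono inter_subset_left) hg.continuous.continuousOn
        (fun y hy => ⟨hy.1.1, subset_closure hy⟩) inter_subset_right
    exact ⟨_, fun y hy y' hy' => by rw [heq hy, heq hy']; exact hg y y'⟩
  · obtain ⟨j, hj⟩ := hd.exists_mem_approxLipschitzSet
    obtain ⟨i, hi⟩ :=
      (TopologicalSpace.denseRange_denseSeq (EuclideanSpace ℝ (Fin n))).exists_dist_lt x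
        (show (0 : ℝ) < 1 / (2 * (j + 1)) by positivity)
    refine mem_iUnion.2 ⟨Nat.pair j i, hx, ?_⟩
    rw [Nat.unpair_pair]
    exact subset_closure ⟨⟨hx, hj⟩, hi.le⟩

/-- The area inequality for continuous, almost everywhere approximately differentiable maps
with the Lusin condition (N). -/
theorem volume_image_le_lintegral_approxJacobian (hΩ : IsOpen Ω) (hh : ContinuousOn h Ω)
    (hN : LusinN h Ω) (hd : ∀ᵐ x ∂volume.restrict Ω, ApproxDifferentiableAt h x)
    (hs : MeasurableSet s) (hsΩ : s ⊆ Ω) :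
    volume (h '' s) ≤ ∫⁻ x in s, ‖approxJacobian h x‖ₑ := by
  obtain ⟨P, hPm, hPΩ, hPL, hP⟩ := exists_measurableSet_lipschitzOnWith_cover hΩ hh
  let B : ℕ → Set (EuclideanSpace ℝ (Fin n)) := fun i => s ∩ disjointed P i
  have hBm : ∀ i, MeasurableSet (B i) := fun i => hs.inter (MeasurableSet.disjointed hPm i)
  have hBd : Pairwise (Function.onFun Disjoint B) := fun i j hij =>
    (disjoint_disjointed P hij).mono inter_subset_right inter_subset_right
  have hBU : ⋃ i, B i = s ∩ ⋃ i, P i := by rw [← inter_iUnion, iUnion_disjointed]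
  have hnull : volume (s \ ⋃ i, P i) = 0 := by
    rw [ae_restrict_iff' hΩ.measurableSet] at hd
    refine measure_mono_null (fun x hx => ?_) (ae_iff.1 hd)
    exact fun hx' => hx.2 (hP x (hsΩ hx.1) (hx' (hsΩ hx.1)))
  calc volume (h '' s) ≤ volume (h '' (s ∩ ⋃ i, P i)) + volume (h '' (s \ ⋃ i, P i)) := by
        conv_lhs => rw [← inter_union_sdiff s (⋃ i, P i), image_union]
        exact measure_union_le _ _
    _ = volume (⋃ i, h '' B i) := by
        rw [hN _ (sdiff_subset.trans hsΩ) hnull, add_zero, ← hBU, image_iUnion]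
    _ ≤ ∑' i, volume (h '' B i) := measure_iUnion_le _
    _ ≤ ∑' i, ∫⁻ x in B i, ‖approxJacobian h x‖ₑ := by
        refine ENNReal.tsum_le_tsum fun i => ?_
        obtain ⟨K, hK⟩ := hPL i
        have hBP : B i ⊆ P i := inter_subset_right.trans (disjointed_subset P i)
        exact (hK.mono hBP).volume_image_le_lintegral_approxJacobian (hBm i)
          (fun Z hZ => hN Z (hZ.trans (hBP.trans (hPΩ i))))
          (ae_mono (Measure.restrict_mono (hBP.trans (hPΩ i)) le_rfl) hd)
    _ = ∫⁻ x in ⋃ i, B i, ‖approxJacobian h x‖ₑ := (lintegral_iUnion hBm hBd _).symm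
    _ ≤ _ := lintegral_mono_set (hBU ▸ inter_subset_left)

end ApproximateDifferentiability

/-! ### Stability of the degree and semicontinuity of image volume -/

section ConvergenceOfImages

open Set Metric

theorem exists_contDiff_dist_lt_of_continuousOn_isClosed {E F : Type*} [NormedAddCommGroup E]
    [NormedSpace ℝ E] [FiniteDimensional ℝ E] [NormedAddCommGroup F] [NormedSpace ℝ F]
    [FiniteDimensional ℝ F] {h : E → F} {K : Set E} (hK : IsClosed K) (hh : ContinuousOn h K)
    {ε : ℝ} (hε : 0 < ε) : ∃ g : E → F, ContDiff ℝ 1 g ∧ ∀ x ∈ K, dist (g x) (h x) < ε := by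
  obtain ⟨H, hH⟩ := ContinuousMap.exists_restrict_eq hK ⟨K.domRestrict h, hh.domRestrict⟩
  obtain ⟨g, hg, hgH, -⟩ := H.continuous.exists_contDiff_approx 1
    (ε := fun _ => ε) continuous_const fun _ => hε
  refine ⟨g, hg, fun x hx => ?_⟩
  have hHx : H x = h x := congrArg (fun u : C(K, F) => u ⟨x, hx⟩) hH
  exact hHx ▸ hgH x

theorem MeasureTheory.measure_le_liminf_of_ae_eventually_mem {α : Type*} [MeasurableSpace α]
    {μ : Measure α} {s : Set α} {t : ℕ → Set α} (h : ∀ᵐ y ∂μ, y ∈ s → ∀ᶠ k in atTop, y ∈ t k) :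
    μ s ≤ liminf (fun k => μ (t k)) atTop := by
  calc μ s ≤ μ (⋃ m, ⋂ k ≥ m, t k) := by
        refine measure_mono_ae ?_
        filter_upwards [h] with y hy hys
        obtain ⟨m, hm⟩ := eventually_atTop.1 (hy hys)
        exact mem_iUnion.2 ⟨m, mem_iInter₂.2 hm⟩
    _ = ⨆ m, μ (⋂ k ≥ m, t k) := by
        refine Monotone.measure_iUnion fun m m' hm => ?_
        exact biInter_mono (fun k hk => le_trans hm hk) fun _ _ => le_rfl
    _ ≤ ⨆ m, ⨅ k ≥ m, μ (t k) :=
        iSup_mono fun m => le_iInf₂ fun k hk => measure_mono (biInter_subset_of_mem hk)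
    _ = _ := liminf_eq_iSup_iInf_of_nat.symm

variable {n : ℕ} {f h : EuclideanSpace ℝ (Fin n) → EuclideanSpace ℝ (Fin n)}
  {fk : ℕ → EuclideanSpace ℝ (Fin n) → EuclideanSpace ℝ (Fin n)}
  {U V K E Ω : Set (EuclideanSpace ℝ (Fin n))} {y : EuclideanSpace ℝ (Fin n)}

/-- A nonzero value cannot be the default, so existence of the degree need not be proved. -/
theorem isBrouwerDegree_of_brouwerDegree_ne_zero (hd : brouwerDegree f U y ≠ 0) :
    IsBrouwerDegree f U y (brouwerDegree f U y) := by
  by_cases hex : ∃ d, IsBrouwerDegree f U y d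
  · have : brouwerDegree f U y = Classical.choose hex := dif_pos hex
    rw [this]
    exact Classical.choose_spec hex
  · exact absurd (dif_neg hex) hd

/-- A value of nonzero degree is attained by all maps that are close enough. -/
theorem IsBrouwerDegree.mem_image_closure {d : ℤ} (hd : IsBrouwerDegree f U y d) (hd0 : d ≠ 0)
    (hU : Bornology.IsBounded U) (hh : ContinuousOn h (closure U)) {ρ : ℝ}
    (hρ : ρ < infDist y (f '' frontier U)) (hhf : ∀ x ∈ closure U, dist (h x) (f x) ≤ ρ) :
    y ∈ h '' closure U := by
  by_contra hy
  have hclosed : IsClosed (h '' closure U) :=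
    (hU.isCompact_closure.image_of_continuousOn hh).isClosed
  obtain ⟨η, hη, hball⟩ := Metric.isOpen_iff.1 hclosed.isOpen_compl y hy
  -- The bound `η` makes `g` miss `y`, so `y` is vacuously regular with an empty degree sum; the
  -- slack above `ρ` keeps `g` admissible for the degree of `f`.
  obtain ⟨g, hg, hgh⟩ := exists_contDiff_dist_lt_of_continuousOn_isClosed isClosed_closure hh
    (lt_min hη (sub_pos.2 hρ))
  have hgy : ∀ x ∈ closure U, g x ≠ y := by
    intro x hx hxy
    refine hball (a := h x) ?_ (mem_image_of_mem h hx)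
    rw [mem_ball, dist_comm, ← hxy]
    exact (hgh x hx).trans_le (min_le_left _ _)
  have hdeg : regularDegree g U y = d := by
    refine hd.2 g ⟨univ, isOpen_univ, subset_univ _, hg.contDiffOn⟩ (fun x hx => ?_) ?_
    · calc dist (g x) (f x) ≤ dist (g x) (h x) + dist (h x) (f x) := dist_triangle _ _ _
        _ < (infDist y (f '' frontier U) - ρ) + ρ :=
          add_lt_add_of_lt_of_le ((hgh x hx).trans_le (min_le_right _ _)) (hhf x hx)
        _ = _ := sub_add_cancel _ _
    · rintro (⟨x, hx, hxy⟩ | ⟨x, hx, hxy⟩)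
      · exact hgy x hx.1 hxy
      · exact hgy x (frontier_subset_closure hx) hxy
  have hempty : U ∩ g ⁻¹' {y} = ∅ :=
    eq_empty_of_forall_notMem fun x hx => hgy x (subset_closure hx.1) hx.2
  rw [regularDegree, hempty, finsum_mem_empty] at hdeg
  exact hd0 hdeg.symm

theorem eventually_mem_image_closedBall [NeZero n] {x : EuclideanSpace ℝ (Fin n)} {r : ℝ}
    (hr : 0 < r) (hcont : ∀ k, ContinuousOn (fk k) (closedBall x r))
    (hconv : TendstoUniformlyOn fk f atTop (closedBall x r))
    (hd : brouwerDegree f (ball x r) y ≠ 0) : ∀ᶠ k in atTop, y ∈ fk k '' closedBall x r := by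
  have hdeg := isBrouwerDegree_of_brouwerDegree_ne_zero hd
  have hf : ContinuousOn f (closedBall x r) :=
    hconv.continuousOn (Frequently.of_forall hcont)
  have hcl : closure (ball x r) = closedBall x r := closure_ball x hr.ne'
  have hfr : frontier (ball x r) = sphere x r := frontier_ball x hr.ne'
  have hpos : 0 < infDist y (f '' frontier (ball x r)) := by
    refine (IsClosed.notMem_iff_infDist_pos ?_ ?_).1 hdeg.1
    · rw [hfr]
      exact ((isCompact_sphere x r).image_of_continuousOn
        (hf.mono sphere_subset_closedBall)).isClosed
    -- Nonemptiness matters, since `infDist` to the empty set is `0`; it holds as `n ≠ 0`.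
    · rw [hfr]
      exact (NormedSpace.sphere_nonempty.2 hr.le).image f
  filter_upwards [Metric.tendstoUniformlyOn_iff.1 hconv _ (half_pos hpos)] with k hk
  rw [← hcl]
  refine hdeg.mem_image_closure hd isBounded_ball (hcl ▸ hcont k) (half_lt_self hpos) ?_
  rw [hcl]
  exact fun z hz => dist_comm (f z) (fk k z) ▸ (hk z hz).le

/-- Balls are connected with null boundary, so the degree hypothesis applies to them. Countably many
cover `V`, so the exceptional values form a null set. -/
theorem ae_eventually_mem_image [NeZero n] (hcont : ∀ k, ContinuousOn (fk k) Ω)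
    (hconv : TendstoLocallyUniformlyOn fk f atTop Ω)
    (hdeg : ∀ U : Set (EuclideanSpace ℝ (Fin n)), IsOpen U → IsConnected U →
      CompactlyContained U Ω → volume (frontier U) = 0 →
      ∀ᵐ y ∂volume, y ∈ f '' U → brouwerDegree f U y ≠ 0)
    (hV : IsOpen V) (hVΩ : V ⊆ Ω) :
    ∀ᵐ y ∂volume, y ∈ f '' V → ∀ᶠ k in atTop, y ∈ fk k '' V := by
  have hball : ∀ x ∈ V, ∃ r > 0, closedBall x r ⊆ V := fun x hx =>
    nhds_basis_closedBall.mem_iff.1 (hV.mem_nhds hx)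
  choose! r hr hrV using hball
  obtain ⟨t, htV, htc, hcov⟩ := TopologicalSpace.countable_cover_nhdsWithin
    (s := V) (f := fun x => ball x (r x)) fun x hx =>
      mem_nhdsWithin_of_mem_nhds (ball_mem_nhds x (hr x hx))
  have hae : ∀ᵐ y ∂volume, ∀ x ∈ t, y ∈ f '' ball x (r x) →
      brouwerDegree f (ball x (r x)) y ≠ 0 := by
    refine (ae_ball_iff htc).2 fun x hx => ?_
    have hrx := hr x (htV hx)
    refine hdeg _ isOpen_ball ((convex_ball x _).isConnected (nonempty_ball.2 hrx)) ?_ ?_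
    · rw [CompactlyContained, closure_ball x hrx.ne']
      exact ⟨isCompact_closedBall x _, (hrV x (htV hx)).trans hVΩ⟩
    · rw [frontier_ball x hrx.ne']
      exact Measure.addHaar_sphere_of_ne_zero volume x hrx.ne'
  filter_upwards [hae] with y hy hyV
  obtain ⟨z, hz, rfl⟩ := hyV
  obtain ⟨x, hx, hzx⟩ := mem_iUnion₂.1 (hcov hz)
  have hsub := (hrV x (htV hx)).trans hVΩ
  filter_upwards [eventually_mem_image_closedBall (hr x (htV hx)) (fun k => (hcont k).mono hsub)
    ((tendstoLocallyUniformlyOn_iff_tendstoUniformlyOn_of_compact (isCompact_closedBall x _)).1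
      (hconv.mono hsub)) (hy x hx (mem_image_of_mem f hzx))] with k hk
  exact image_mono (hrV x (htV hx)) hk

/-- Maps with uniformly integrable approximate Jacobians have uniformly small images of small
sets. -/
theorem exists_forall_volume_image_le (hΩ : IsOpen Ω) (hcont : ∀ k, ContinuousOn (fk k) Ω)
    (hNk : ∀ k, LusinN (fk k) Ω)
    (hdk : ∀ k, ∀ᵐ x ∂(volume.restrict Ω), ApproxDifferentiableAt (fk k) x)
    (hK : IsCompact K) (hKΩ : K ⊆ Ω)
    (hUI : UnifIntegrable (fun k => approxJacobian (fk k)) 1 (volume.restrict K))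
    {ε : ℝ} (hε : 0 < ε) :
    ∃ δ : ENNReal, δ ≠ 0 ∧ ∀ k, ∀ A ⊆ K, volume A ≤ δ →
      volume (fk k '' A) ≤ ENNReal.ofReal ε := by
  obtain ⟨δ, hδ, hUI⟩ := hUI hε
  refine ⟨ENNReal.ofReal δ, (ENNReal.ofReal_pos.2 hδ).ne', fun k A hAK hA => ?_⟩
  -- `A` is arbitrary, whereas uniform integrability speaks of measurable sets.
  have hm : MeasurableSet (toMeasurable volume A) := measurableSet_toMeasurable _ _
  have hδA : volume.restrict K (toMeasurable volume A) ≤ ENNReal.ofReal δ := by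
    refine (Measure.restrict_apply_le K _).trans ?_
    rwa [measure_toMeasurable]
  calc volume (fk k '' A) ≤ volume (fk k '' (toMeasurable volume A ∩ K)) :=
        measure_mono (image_mono (subset_inter (subset_toMeasurable _ _) hAK))
    _ ≤ ∫⁻ x in toMeasurable volume A ∩ K, ‖approxJacobian (fk k) x‖ₑ :=
        volume_image_le_lintegral_approxJacobian hΩ (hcont k) (hNk k) (hdk k)
          (hm.inter hK.measurableSet) (inter_subset_right.trans hKΩ)
    _ = eLpNorm ((toMeasurable volume A).indicator (approxJacobian (fk k))) 1
          (volume.restrict K) := by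
        rw [eLpNorm_indicator_eq_eLpNorm_restrict hm, eLpNorm_one_eq_lintegral_enorm,
          Measure.restrict_restrict hm]
    _ ≤ _ := hUI k _ hm hδA

/-- The closed thickenings of the compact set `f '' K` shrink to it in volume. -/
theorem limsup_volume_image_le_of_isCompact (hK : IsCompact K) (hf : ContinuousOn f K)
    (hconv : TendstoUniformlyOn fk f atTop K) :
    limsup (fun k => volume (fk k '' K)) atTop ≤ volume (f '' K) := by
  refine ge_of_tendsto ((tendsto_measure_cthickening_of_isCompact
    (μ := volume) (hK.image_of_continuousOn hf)).mono_left (nhdsWithin_le_nhds (s := Ioi 0))) ?_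
  filter_upwards [self_mem_nhdsWithin] with δ hδ
  refine limsup_le_of_le (by isBoundedDefault) ?_
  filter_upwards [Metric.tendstoUniformlyOn_iff.1 hconv δ hδ] with k hk
  refine measure_mono ?_
  rintro _ ⟨x, hx, rfl⟩
  exact mem_cthickening_of_dist_le _ _ _ _ (mem_image_of_mem f hx)
    (dist_comm (f x) (fk k x) ▸ (hk x hx).le)

end ConvergenceOfImages

/-! ### Approximation of a measurable set from outside and inside -/

theorem theorem1p7 (n : ℕ) (hn : 2 ≤ n)
    (Ω : Set (EuclideanSpace ℝ (Fin n)))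
    (hΩo : IsOpen Ω) (hΩc : IsConnected Ω) (hΩb : Bornology.IsBounded Ω)
    (fk : ℕ → EuclideanSpace ℝ (Fin n) → EuclideanSpace ℝ (Fin n))
    (f : EuclideanSpace ℝ (Fin n) → EuclideanSpace ℝ (Fin n))
    (hcont : ∀ k, ContinuousOn (fk k) Ω)
    (hconv : TendstoLocallyUniformlyOn fk f atTop Ω)
    (hNk : ∀ k, LusinN (fk k) Ω)
    (hN : LusinN f Ω)
    (hdk : ∀ k, ∀ᵐ x ∂(volume.restrict Ω), ApproxDifferentiableAt (fk k) x)
    (hd : ∀ᵐ x ∂(volume.restrict Ω), ApproxDifferentiableAt f x)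
    (hUI : ∀ K ⊆ Ω, IsCompact K →
      UniformIntegrable (fun k => approxJacobian (fk k)) 1 (volume.restrict K))
    (hdeg : ∀ U : Set (EuclideanSpace ℝ (Fin n)), IsOpen U → IsConnected U →
      CompactlyContained U Ω → volume (frontier U) = 0 →
      ∀ᵐ y ∂volume, y ∈ f '' U → brouwerDegree f U y ≠ 0)
    (E : Set (EuclideanSpace ℝ (Fin n))) (hE : NullMeasurableSet E volume)
    (hEΩ : CompactlyContained E Ω) :
    Tendsto (fun k => volume (fk k '' E)) atTop (𝓝 (volume (f '' E))) := by
  have : NeZero n := ⟨by omega⟩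
  have hf : ContinuousOn f Ω := hconv.continuousOn (Frequently.of_forall hcont)
  -- `K` leaves room for open neighbourhoods of `E` inside one compact set, where the Jacobians are
  -- uniformly integrable.
  obtain ⟨K, hK, hEK, hKΩ⟩ := exists_compact_between hEΩ.1 hΩo hEΩ.2
  have hEK' : E ⊆ interior K := subset_closure.trans hEK
  have hEfin : volume E ≠ ⊤ :=
    measure_ne_top_of_subset subset_closure hEΩ.1.measure_lt_top.ne
  have hsmall := fun ε : NNReal => exists_forall_volume_image_le (ε := ε) hΩo hcont hNk hdk hK hKΩ
    (hUI K hKΩ hK).2.1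
  simp only [ENNReal.ofReal_coe_nnreal] at hsmall
  refine tendsto_of_le_liminf_of_limsup_le ?_ ?_
  · refine ENNReal.le_of_forall_pos_le_add fun ε hε _ => ?_
    obtain ⟨δ, hδ, hsmall⟩ := hsmall ε (by exact_mod_cast hε)
    obtain ⟨W, hEW, hW, hWlt⟩ := E.exists_isOpen_lt_add hEfin hδ
    have hVo : IsOpen (W ∩ interior K) := hW.inter isOpen_interior
    have hEV : E ⊆ W ∩ interior K := Set.subset_inter hEW hEK'
    have hVK : W ∩ interior K ⊆ K := Set.inter_subset_right.trans interior_subset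
    have hdiff : volume ((W ∩ interior K) \ E) ≤ δ :=
      (measure_sdiff_lt_of_lt_add hE hEV hEfin
        ((measure_mono Set.inter_subset_left).trans_lt hWlt)).le
    calc volume (f '' E) ≤ volume (f '' (W ∩ interior K)) := measure_mono (Set.image_mono hEV)
      _ ≤ liminf (fun k => volume (fk k '' (W ∩ interior K))) atTop :=
          measure_le_liminf_of_ae_eventually_mem
            (ae_eventually_mem_image hcont hconv hdeg hVo (hVK.trans hKΩ))
      _ ≤ liminf (fun k => volume (fk k '' E) + ε) atTop := by
          refine liminf_le_liminf (Eventually.of_forall fun k => ?_)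
          calc volume (fk k '' (W ∩ interior K))
              ≤ volume (fk k '' E) + volume (fk k '' ((W ∩ interior K) \ E)) := by
                rw [← Set.union_sdiff_cancel hEV, Set.image_union, Set.union_sdiff_cancel hEV]
                exact measure_union_le _ _
            _ ≤ _ := by
                refine add_le_add le_rfl ?_
                exact hsmall k _ (Set.sdiff_subset.trans hVK) hdiff
      _ = liminf (fun k => volume (fk k '' E)) atTop + ε :=
          liminf_add_const _ _ _ (by isBoundedDefault) (by isBoundedDefault)
  · refine ENNReal.le_of_forall_pos_le_add fun ε hε _ => ?_
    obtain ⟨δ, hδ, hsmall⟩ := hsmall ε (by exact_mod_cast hε)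
    -- Inner regularity is applied to a measurable subset of full measure in `E`.
    obtain ⟨E', hE'E, hE'm, hE'⟩ := hE.exists_measurable_subset_ae_eq
    have hE'fin : volume E' ≠ ⊤ := measure_ne_top_of_subset hE'E hEfin
    obtain ⟨C, hCE', hC, hClt⟩ := hE'm.exists_isCompact_lt_add hE'fin hδ
    have hCE : C ⊆ E := hCE'.trans hE'E
    have hCΩ : C ⊆ Ω := hCE.trans (subset_closure.trans hEΩ.2)
    have hdiff : volume (E \ C) ≤ δ :=
      (measure_sdiff_lt_of_lt_add hC.measurableSet.nullMeasurableSet hCE hC.measure_lt_top.ne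
        (measure_congr hE' ▸ hClt)).le
    calc limsup (fun k => volume (fk k '' E)) atTop
        ≤ limsup (fun k => volume (fk k '' C) + ε) atTop := by
          refine limsup_le_limsup (Eventually.of_forall fun k => ?_)
          calc volume (fk k '' E) ≤ volume (fk k '' C) + volume (fk k '' (E \ C)) := by
                rw [← Set.union_sdiff_cancel hCE, Set.image_union, Set.union_sdiff_cancel hCE]
                exact measure_union_le _ _
            _ ≤ _ := by
                refine add_le_add le_rfl ?_
                exact hsmall k _ (Set.sdiff_subset.trans (hEK'.trans interior_subset)) hdiff
      _ = limsup (fun k => volume (fk k '' C)) atTop + ε :=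
          limsup_add_const _ _ _ (by isBoundedDefault) (by isBoundedDefault)
      _ ≤ volume (f '' E) + ε := by
          gcongr
          refine (limsup_volume_image_le_of_isCompact hC (hf.mono hCΩ) ?_).trans
            (measure_mono (Set.image_mono hCE))
          exact (tendstoLocallyUniformlyOn_iff_tendstoUniformlyOn_of_compact hC).1
            (hconv.mono hCΩ)
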